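/- Let $r\ge 1$ and let $n_1,\dots,n_r\ge 1$ be positive integers. Let $M=S^{n_1}\times\cdots\times S^{n_r}$ be the product of the standard unit spheres $S^{n_i}\subset\mathbb{R}^{n_i+1}$, with its product smooth structure. Then the Whitney sum $TM\oplus\varepsilon^1_M$ of the tangent bundle of $M$ with the trivial real line bundle over $M$ is a trivial smooth vector bundle. Moreover (Kervaire, sufficiency), if $r\ge 2$ and at least one of the $n_i$ is odd, then $M$ is parallelizable, that is, its tangent bundle $TM$ is a trivial smooth vector bundle. (A smooth real vector bundle of rank $k$ is trivial if it admits a global smooth frame, i.e. $k$ smooth global sections whose values form a basis of every fibre.) -/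

import Mathlib

open scoped Manifold ContDiff Bundle

noncomputable section

/-- A finite product of `C^k` manifolds, with the product charts, is a `C^k` manifold. -/
instance IsManifold.piProduct {ι : Type*} [Fintype ι] {k : ℕ∞ω}
    {E : ι → Type*} [∀ i, NormedAddCommGroup (E i)] [∀ i, NormedSpace ℝ (E i)]
    {H : ι → Type*} [∀ i, TopologicalSpace (H i)] (I : ∀ i, ModelWithCorners ℝ (E i) (H i))
    (M : ι → Type*) [∀ i, TopologicalSpace (M i)] [∀ i, ChartedSpace (H i) (M i)]
    [∀ i, IsManifold (I i) k (M i)] :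
    IsManifold (ModelWithCorners.pi I) k (∀ i, M i) := by
  apply isManifold_of_contDiffOn
  rintro e e' ⟨f, hf, rfl⟩ ⟨g, hg, rfl⟩
  rw [contDiffOn_pi]
  intro i
  have h := (contDiffGroupoid k (I i)).compatible (hf i trivial) (hg i trivial)
  rw [contDiffGroupoid, mem_groupoid_of_pregroupoid] at h
  have h1 : ContDiffOn ℝ k (I i ∘ ((f i).symm ≫ₕ g i) ∘ (I i).symm)
      ((I i).symm ⁻¹' ((f i).symm ≫ₕ g i).source ∩ Set.range (I i)) := h.1
  refine h1.comp (ContinuousLinearMap.proj (R := ℝ) (φ := E) i).contDiff.contDiffOn ?_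
  rintro x ⟨⟨hx1, hx2⟩, y, rfl⟩
  exact ⟨⟨hx1 i trivial, hx2 i trivial⟩, y i, rfl⟩

/-- A smooth real vector bundle `V` of finite rank, with model fibre `F`, is trivial if it has a
global smooth frame: smooth sections, as many as the rank, that form a basis of every fibre. -/
def IsTrivialVectorBundle {E H M : Type*} [NormedAddCommGroup E] [NormedSpace ℝ E]
    [TopologicalSpace H] (I : ModelWithCorners ℝ E H) [TopologicalSpace M] [ChartedSpace H M]
    (F : Type*) [NormedAddCommGroup F] [NormedSpace ℝ F]
    (V : M → Type*) [TopologicalSpace (Bundle.TotalSpace F V)]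
    [∀ x, AddCommGroup (V x)] [∀ x, Module ℝ (V x)] [∀ x, TopologicalSpace (V x)]
    [FiberBundle F V] : Prop :=
  ∃ s : Fin (Module.finrank ℝ F) → (x : M) → V x, IsLocalFrameOn I F ∞ s Set.univ

/-- A smooth manifold is parallelizable if its tangent bundle is trivial. -/
def IsParallelizable {E H : Type*} [NormedAddCommGroup E] [NormedSpace ℝ E]
    [TopologicalSpace H] (I : ModelWithCorners ℝ E H)
    (M : Type*) [TopologicalSpace M] [ChartedSpace H M] [IsManifold I ∞ M] : Prop :=
  IsTrivialVectorBundle I E (TangentSpace I : M → Type _)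

/-- The Whitney sum of the tangent bundle with the trivial line bundle is trivial. -/
def TangentPlusLineIsTrivial {E H : Type*} [NormedAddCommGroup E] [NormedSpace ℝ E]
    [TopologicalSpace H] (I : ModelWithCorners ℝ E H)
    (M : Type*) [TopologicalSpace M] [ChartedSpace H M] [IsManifold I ∞ M] : Prop :=
  IsTrivialVectorBundle I (E × ℝ) ((TangentSpace I : M → Type _) ×ᵇ Bundle.Trivial M ℝ)

/-- The standard unit sphere of dimension `m`, in Euclidean `(m + 1)`-space. -/
abbrev StdSphere (m : ℕ) : Type := Metric.sphere (0 : EuclideanSpace ℝ (Fin (m + 1))) 1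

/-- The product of spheres of dimensions `n 0, …, n (r - 1)`. -/
abbrev SphereProduct {r : ℕ} (n : Fin r → ℕ) : Type := ∀ i, StdSphere (n i)

/-- The model with corners (without boundary) of the product manifold. -/
abbrev sphereProductModel {r : ℕ} (n : Fin r → ℕ) :
    ModelWithCorners ℝ (∀ i, EuclideanSpace ℝ (Fin (n i)))
      (ModelPi fun i => EuclideanSpace ℝ (Fin (n i))) :=
  ModelWithCorners.pi fun i => 𝓡 (n i)

end

/-!
A tangent vector of a product of spheres at `x` is a tuple of vectors `v i`, with `v i` orthogonal
to the unit vector `x i`. The basic splitting is `T S^m ⊕ ε¹ ≅ ε^(m+1) ≅ ε^m ⊕ ε¹`: a vector of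
`ℝ^(m+1)` is the sum of its orthogonal projection to `xᗮ` and a multiple of `x`, and
`ℝ^(m+1) ≅ ℝ^m × ℝ`. The splitting turns `ε^m ⊕ ε¹` into `T S^m ⊕ ε¹` and hands the line on, so that
one line is enough to treat all factors in turn:
`⨁ i, ε^(n i) ⊕ ε¹ ≅ ⨁ i, T S^(n i) ⊕ ε¹`
(`exists_tangential_family_add_line`). This is the triviality of `TM ⊕ ε¹`.

Let now `n a` be odd and let `b` be another index. An orthogonal complex structure `J` on the
ambient space of the sphere `S^(n a)` gives the unit tangent field `x ↦ J x`, hence a splitting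
`T S^(n a) = η ⊕ ε¹`. Starting from `⨁ i, ε^(n i)`, one coordinate of the factor `b` serves as the
line that turns `ε^(n a)` into `T S^(n a)`, and the line handed on is put back as that coordinate.
The line spanned by `J x` in `T S^(n a)` is then used to turn the other factors into tangent
bundles, and the line handed on at the end is again taken as the line spanned by `J x`
(`exists_tangential_family`).

Both constructions are families of injective linear maps from a fixed vector space to tuples of
ambient vectors, orthogonal to the `x i` and depending smoothly on `x`. They become frames of the
intrinsic bundles through `StdSphere.toTangent`, a smooth family of linear maps from the ambient
space to the tangent spaces of the sphere, which the differential of the inclusion takes to the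
orthogonal projection. Vector fields on the product are smooth if their components are
(`contMDiff_pi_section`).
-/

open Set Filter Topology RealInnerProductSpace

/-! ### Vector fields on product manifolds and sections of Whitney sums -/

section ProductManifold

variable {ι : Type*} [Fintype ι] {k : ℕ∞ω}
  {E : ι → Type*} [∀ i, NormedAddCommGroup (E i)] [∀ i, NormedSpace ℝ (E i)]
  {H : ι → Type*} [∀ i, TopologicalSpace (H i)] {I : ∀ i, ModelWithCorners ℝ (E i) (H i)}
  {M : ι → Type*} [∀ i, TopologicalSpace (M i)] [∀ i, ChartedSpace (H i) (M i)]

theorem contMDiff_eval_pi (i : ι) :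
    ContMDiff (ModelWithCorners.pi I) (I i) k (fun x : ∀ i, M i => x i) := by
  intro x
  rw [contMDiffAt_iff]
  refine ⟨(continuous_apply i).continuousAt, ?_⟩
  have h : ContDiffWithinAt ℝ k (fun y : ∀ i, E i => y i) (range (ModelWithCorners.pi I))
      (extChartAt (ModelWithCorners.pi I) x x) :=
    (ContinuousLinearMap.proj (R := ℝ) (φ := E) i).contDiff.contDiffWithinAt
  refine h.congr_of_eventuallyEq ?_ ?_
  -- In the product charts the projection is the coordinate projection of the model space.
  · filter_upwards [extChartAt_target_mem_nhdsWithin (I := ModelWithCorners.pi I) x] with y hy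
    have hy' := (extChartAt (ModelWithCorners.pi I) x).right_inv hy
    exact congrFun hy' i
  · have hy' := (extChartAt (ModelWithCorners.pi I) x).right_inv
      (mem_extChartAt_target (I := ModelWithCorners.pi I) x)
    exact congrFun hy' i

variable [∀ i, IsManifold (I i) 1 (M i)]

/-- The tangent coordinate changes of a product manifold act factor by factor. -/
theorem tangentCoordChange_pi_apply {x y z : ∀ i, M i}
    (hx : ∀ i, z i ∈ (chartAt (H i) (x i)).source) (hy : ∀ i, z i ∈ (chartAt (H i) (y i)).source)
    (v : ∀ i, E i) (i : ι) :
    tangentCoordChange (ModelWithCorners.pi I) x y z v i =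
      tangentCoordChange (I i) (x i) (y i) (z i) (v i) := by
  have hpi : HasFDerivWithinAt
      (extChartAt (ModelWithCorners.pi I) y ∘ (extChartAt (ModelWithCorners.pi I) x).symm)
      (ContinuousLinearMap.pi fun i =>
        (tangentCoordChange (I i) (x i) (y i) (z i)).comp (ContinuousLinearMap.proj i))
      (range (ModelWithCorners.pi I)) (extChartAt (ModelWithCorners.pi I) x z) := by
    rw [hasFDerivWithinAt_pi']
    intro j
    have hj := hasFDerivWithinAt_tangentCoordChange (I := I j) (x := x j) (y := y j) (z := z j)
      (by simpa only [extChartAt_source] using ⟨hx j, hy j⟩)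
    refine HasFDerivWithinAt.comp (t := range (I j)) (extChartAt (ModelWithCorners.pi I) x z)
      (f := fun w : ∀ i, E i => w j) hj
      (ContinuousLinearMap.proj (R := ℝ) (φ := E) j).hasFDerivWithinAt ?_
    rintro _ ⟨w, rfl⟩
    exact ⟨w j, rfl⟩
  have h := hasFDerivWithinAt_tangentCoordChange (I := ModelWithCorners.pi I) (x := x) (y := y)
    (z := z) (by
      simp only [extChartAt_source]
      exact ⟨fun i _ => hx i, fun i _ => hy i⟩)
  have huniq := (ModelWithCorners.pi I).uniqueDiffOn _ (mem_range_self (chartAt (ModelPi H) x z))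
  have := huniq.eq h hpi
  exact congrFun (congrArg (fun L => L v) this) i

/-- A vector field on a product manifold is `C^k` as soon as each of its components, a vector
field along a projection, is. -/
theorem contMDiff_pi_section {s : ∀ x : ∀ i, M i, ∀ i, TangentSpace (I i) (x i)}
    (hs : ∀ i, ContMDiff (ModelWithCorners.pi I) (I i).tangent k
      (fun x : ∀ i, M i => (⟨x i, s x i⟩ : TangentBundle (I i) (M i)))) :
    ContMDiff (ModelWithCorners.pi I) (ModelWithCorners.pi I).tangent k
      (fun x : ∀ i, M i => (⟨x, s x⟩ : TangentBundle (ModelWithCorners.pi I) (∀ i, M i))) := by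
  intro x₀
  refine (Bundle.contMDiffAt_section (E := TangentSpace (ModelWithCorners.pi I)) x₀).2
    (contMDiffAt_pi_space.2 fun i => ?_)
  have hi := ((Bundle.contMDiffAt_totalSpace).1 (hs i x₀)).2
  refine hi.congr_of_eventuallyEq ?_
  filter_upwards [(chartAt (ModelPi H) x₀).open_source.mem_nhds (mem_chart_source _ x₀)] with x hx
  exact tangentCoordChange_pi_apply (I := I) (x := x) (y := x₀) (z := x)
    (fun i => mem_chart_source _ _) (fun i => hx i (mem_univ i)) (s x) i

end ProductManifold

section WhitneySum

variable {𝕜 B F₁ F₂ EB HB : Type*} [NontriviallyNormedField 𝕜]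
  [NormedAddCommGroup F₁] [NormedSpace 𝕜 F₁] [NormedAddCommGroup F₂] [NormedSpace 𝕜 F₂]
  [NormedAddCommGroup EB] [NormedSpace 𝕜 EB] [TopologicalSpace HB]
  {IB : ModelWithCorners 𝕜 EB HB} [TopologicalSpace B] [ChartedSpace HB B] {k : ℕ∞ω}

theorem ContMDiff.section_trivial {f : B → F₂} (hf : ContMDiff IB 𝓘(𝕜, F₂) k f) :
    ContMDiff IB (IB.prod 𝓘(𝕜, F₂)) k
      (fun x => Bundle.TotalSpace.mk' F₂ (E := Bundle.Trivial B F₂) x (f x)) := by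
  intro x₀
  rw [Bundle.contMDiffAt_section]
  exact hf x₀

variable {E₁ E₂ : B → Type*}
  [TopologicalSpace (Bundle.TotalSpace F₁ E₁)] [∀ x, TopologicalSpace (E₁ x)]
  [TopologicalSpace (Bundle.TotalSpace F₂ E₂)] [∀ x, TopologicalSpace (E₂ x)]
  [∀ x, Zero (E₁ x)] [∀ x, Zero (E₂ x)] [FiberBundle F₁ E₁] [FiberBundle F₂ E₂]

theorem ContMDiff.section_whitneySum {s₁ : ∀ x, E₁ x} {s₂ : ∀ x, E₂ x}
    (h₁ : ContMDiff IB (IB.prod 𝓘(𝕜, F₁)) k (fun x => Bundle.TotalSpace.mk' F₁ x (s₁ x)))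
    (h₂ : ContMDiff IB (IB.prod 𝓘(𝕜, F₂)) k (fun x => Bundle.TotalSpace.mk' F₂ x (s₂ x))) :
    ContMDiff IB (IB.prod 𝓘(𝕜, F₁ × F₂)) k
      (fun x => Bundle.TotalSpace.mk' (F₁ × F₂) (E := E₁ ×ᵇ E₂) x (s₁ x, s₂ x)) := by
  intro x₀
  rw [Bundle.contMDiffAt_section]
  exact ((Bundle.contMDiffAt_section x₀).1 (h₁ x₀)).prodMk_space
    ((Bundle.contMDiffAt_section x₀).1 (h₂ x₀))

end WhitneySum

/-! ### From ambient vectors to tangent vectors of the sphere -/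

noncomputable section Sphere

/-- The map `w ↦ w - ⟪x, w⟫ • x`: for a unit vector `x`, the orthogonal projection onto the
hyperplane `xᗮ`. -/
def tangentialPart {V : Type*} [NormedAddCommGroup V] [InnerProductSpace ℝ V] (x : V) :
    V →L[ℝ] V :=
  ContinuousLinearMap.id ℝ V - (innerSL ℝ x).smulRight x

variable {V : Type*} [NormedAddCommGroup V] [InnerProductSpace ℝ V]

theorem tangentialPart_apply (x w : V) : tangentialPart x w = w - ⟪x, w⟫ • x := by
  simp [tangentialPart]

theorem inner_tangentialPart {x : V} (hx : ‖x‖ = 1) (w : V) : ⟪x, tangentialPart x w⟫ = 0 := by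
  rw [tangentialPart_apply, inner_sub_right, inner_smul_right, real_inner_self_eq_norm_sq, hx]
  ring

theorem tangentialPart_of_inner_eq_zero {x w : V} (h : ⟪x, w⟫ = 0) : tangentialPart x w = w := by
  rw [tangentialPart_apply, h, zero_smul, sub_zero]

/-- For a unit vector `x`, the central projection to the unit sphere of the point `x + w'`, where `w'`
is the tangential part of `w`. It is smooth in all `w` because `x + w'` never vanishes:
Pythagoras shows that the norm of `x + w'` is the square root below. -/
def sphereShift (x w : V) : V :=
  (√(1 + ‖tangentialPart x w‖ ^ 2))⁻¹ • (x + tangentialPart x w)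

theorem norm_sphereShift {x : V} (hx : ‖x‖ = 1) (w : V) : ‖sphereShift x w‖ = 1 := by
  have h : ‖x + tangentialPart x w‖ ^ 2 = 1 + ‖tangentialPart x w‖ ^ 2 := by
    rw [norm_add_sq_real, inner_tangentialPart hx, hx]; ring
  have hpos : 0 < √(1 + ‖tangentialPart x w‖ ^ 2) := by positivity
  rw [sphereShift, norm_smul, norm_inv, Real.norm_of_nonneg hpos.le, ← h,
    Real.sqrt_sq (norm_nonneg _), inv_mul_cancel₀]
  intro h0
  rw [← h, h0] at hpos
  simp at hpos

@[simp]
theorem sphereShift_zero (x : V) : sphereShift x 0 = x := by simp [sphereShift]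

theorem hasFDerivAt_sphereShift (x : V) : HasFDerivAt (sphereShift x) (tangentialPart x) 0 := by
  -- The normalizing factor is stationary at `0`, so that only `x + w'` contributes.
  have h1 : HasFDerivAt (fun w => 1 + ‖tangentialPart x w‖ ^ 2) (0 : V →L[ℝ] ℝ) 0 := by
    simpa using ((tangentialPart x).hasFDerivAt (x := 0)).norm_sq.const_add 1
  have h2 := (hasDerivAt_inv (x := √(1 + ‖tangentialPart x 0‖ ^ 2)) (by simp)).comp_hasFDerivAt 0
    (h1.sqrt (by simp))
  have h3 := h2.smul (((tangentialPart x).hasFDerivAt (x := 0)).const_add x)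
  simpa [sphereShift] using! h3

theorem contDiff_sphereShift {k : ℕ∞ω} :
    ContDiff ℝ k (fun p : V × V => sphereShift p.1 p.2) := by
  have h : ContDiff ℝ k (fun p : V × V => tangentialPart p.1 p.2) := by
    simp only [tangentialPart_apply]
    exact contDiff_snd.sub ((contDiff_fst.inner ℝ contDiff_snd).smul contDiff_fst)
  refine (((contDiff_const.add (h.norm_sq ℝ)).sqrt fun p => ?_).inv fun p => ?_).smul
    (contDiff_fst.add h)
  · positivity
  · positivity

/-- `sphereShift` as a self-map of the standard sphere, depending on a vector parameter. -/
def StdSphere.shift {m : ℕ} (x : StdSphere m) (w : EuclideanSpace ℝ (Fin (m + 1))) : StdSphere m :=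
  ⟨sphereShift (x : EuclideanSpace ℝ (Fin (m + 1))) w,
    mem_sphere_zero_iff_norm.2 (norm_sphereShift (norm_eq_of_mem_sphere x) w)⟩

@[simp]
theorem StdSphere.shift_zero {m : ℕ} (x : StdSphere m) : x.shift 0 = x :=
  Subtype.ext (sphereShift_zero _)

theorem StdSphere.contMDiff_coe {m : ℕ} {k : ℕ∞ω} :
    ContMDiff (𝓡 m) 𝓘(ℝ, EuclideanSpace ℝ (Fin (m + 1))) k
      (fun x : StdSphere m => (x : EuclideanSpace ℝ (Fin (m + 1)))) :=
  have := Fact.mk (@finrank_euclideanSpace_fin ℝ _ (m + 1))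
  contMDiff_coe_sphere

theorem StdSphere.contMDiff_shift {m : ℕ} {k : ℕ∞ω} :
    ContMDiff ((𝓡 m).prod 𝓘(ℝ, EuclideanSpace ℝ (Fin (m + 1)))) (𝓡 m) k
      (Function.uncurry (StdSphere.shift (m := m))) := by
  have := Fact.mk (@finrank_euclideanSpace_fin ℝ _ (m + 1))
  exact ContMDiff.codRestrict_sphere
    (contDiff_sphereShift.contMDiff.comp
      ((StdSphere.contMDiff_coe.comp contMDiff_fst).prodMk_space contMDiff_snd)) _

/-- The surjection from the ambient space onto the tangent space of the sphere at `x`: the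
derivative of `w ↦ x.shift w` at `0`. That derivative takes values in the tangent space at
`x.shift 0`, which is `x` by `StdSphere.shift_zero`; both tangent spaces are the model space by
definition. -/
def StdSphere.toTangent {m : ℕ} (x : StdSphere m) :
    EuclideanSpace ℝ (Fin (m + 1)) →L[ℝ] TangentSpace (𝓡 m) x :=
  mfderiv 𝓘(ℝ, EuclideanSpace ℝ (Fin (m + 1))) (𝓡 m) x.shift 0

/-- In the ambient space, `toTangent` is the orthogonal projection. -/
theorem StdSphere.mfderiv_coe_toTangent {m : ℕ} (x : StdSphere m)
    (w : EuclideanSpace ℝ (Fin (m + 1))) :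
    mfderiv (𝓡 m) 𝓘(ℝ, EuclideanSpace ℝ (Fin (m + 1)))
      (fun y : StdSphere m => (y : EuclideanSpace ℝ (Fin (m + 1)))) x (x.toTangent w) =
    tangentialPart (x : EuclideanSpace ℝ (Fin (m + 1))) w := by
  have h1 : MDifferentiableAt 𝓘(ℝ, EuclideanSpace ℝ (Fin (m + 1))) (𝓡 m) x.shift 0 :=
    ((StdSphere.contMDiff_shift (k := 1)).comp
      (contMDiff_const.prodMk contMDiff_id)).mdifferentiable one_ne_zero 0
  have h2 : MDifferentiableAt (𝓡 m) 𝓘(ℝ, EuclideanSpace ℝ (Fin (m + 1)))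
      (fun y : StdSphere m => (y : EuclideanSpace ℝ (Fin (m + 1)))) (x.shift 0) :=
    (StdSphere.contMDiff_coe (k := 1)).mdifferentiable one_ne_zero _
  have h3 := mfderiv_comp (0 : EuclideanSpace ℝ (Fin (m + 1))) h2 h1
  have h4 : mfderiv 𝓘(ℝ, EuclideanSpace ℝ (Fin (m + 1))) 𝓘(ℝ, EuclideanSpace ℝ (Fin (m + 1)))
      ((fun y : StdSphere m => (y : EuclideanSpace ℝ (Fin (m + 1)))) ∘ x.shift) 0 =
      tangentialPart (x : EuclideanSpace ℝ (Fin (m + 1))) :=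
    (hasFDerivAt_sphereShift (x : EuclideanSpace ℝ (Fin (m + 1)))).hasMFDerivAt.mfderiv
  rw [h4, StdSphere.shift_zero] at h3
  exact (congrArg (fun L => L w) h3).symm

/-- A `C^k` family of ambient vectors along a map `f` to the sphere gives a `C^k` family of tangent
vectors along `f`, since the `mfderiv` of a map that depends smoothly on a parameter is smooth in
the parameter. -/
theorem StdSphere.contMDiff_toTangent {E H N : Type*} [NormedAddCommGroup E] [NormedSpace ℝ E]
    [TopologicalSpace H] {I : ModelWithCorners ℝ E H} [TopologicalSpace N] [ChartedSpace H N]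
    [IsManifold I 1 N]
    {m : ℕ} {k l : ℕ∞ω} (hkl : k + 1 ≤ l) {f : N → StdSphere m}
    {w : N → EuclideanSpace ℝ (Fin (m + 1))}
    (hf : ContMDiff I (𝓡 m) l f) (hw : ContMDiff I 𝓘(ℝ, EuclideanSpace ℝ (Fin (m + 1))) k w) :
    ContMDiff I (𝓡 m).tangent k
      (fun p => (⟨f p, (f p).toTangent (w p)⟩ : TangentBundle (𝓡 m) (StdSphere m))) := by
  intro p₀
  rw [Bundle.contMDiffAt_totalSpace]
  have hk : k ≤ l := le_trans le_self_add hkl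
  refine ⟨(hf p₀).of_le hk, ?_⟩
  have h := ContMDiffAt.mfderiv (J := I) (I := 𝓘(ℝ, EuclideanSpace ℝ (Fin (m + 1))))
    (I' := 𝓡 m) (x₀ := p₀) (fun p => (f p).shift) (fun _ => 0)
    ((StdSphere.contMDiff_shift (k := l)).comp
      ((hf.comp contMDiff_fst).prodMk contMDiff_snd) (p₀, 0))
    contMDiffAt_const hkl
  refine (h.clm_apply (hw p₀)).congr_of_eventuallyEq ?_
  have hopen : f ⁻¹' (chartAt (EuclideanSpace ℝ (Fin m)) (f p₀)).source ∈ 𝓝 p₀ :=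
    hf.continuous.continuousAt.preimage_mem_nhds
      ((chartAt (EuclideanSpace ℝ (Fin m)) (f p₀)).open_source.mem_nhds (mem_chart_source _ _))
  filter_upwards [hopen] with p hp
  have hcoord := inTangentCoordinates_eq (I := 𝓘(ℝ, EuclideanSpace ℝ (Fin (m + 1))))
    (I' := 𝓡 m) (x₀ := p₀) (x := p)
    (fun _ => (0 : EuclideanSpace ℝ (Fin (m + 1)))) (fun p => (f p).shift 0)
    (fun p => mfderiv 𝓘(ℝ, EuclideanSpace ℝ (Fin (m + 1))) (𝓡 m) (f p).shift 0)
    (by simp) (by simpa using hp)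
  rw [tangentBundleCore_coordChange_model_space] at hcoord
  refine Eq.trans ?_ (congrArg (fun L => L (w p)) hcoord).symm
  simp only [StdSphere.shift_zero]
  rfl

end Sphere

/-! ### Families of tangential vectors -/

section Families

variable {B EB HB ι : Type*} [NormedAddCommGroup EB] [NormedSpace ℝ EB] [TopologicalSpace HB]
  {IB : ModelWithCorners ℝ EB HB} [TopologicalSpace B] [ChartedSpace HB B] {k : ℕ∞ω}

theorem ContMDiff.innerSL {V : Type*} [NormedAddCommGroup V] [InnerProductSpace ℝ V] {y : B → V}
    (hy : ContMDiff IB 𝓘(ℝ, V) k y) :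
    ContMDiff IB 𝓘(ℝ, V →L[ℝ] ℝ) k (fun x => _root_.innerSL ℝ (y x)) :=
  (_root_.innerSL ℝ (E := V)).contDiff.contMDiff.comp hy

theorem ContMDiff.tangentialPart {V : Type*} [NormedAddCommGroup V] [InnerProductSpace ℝ V]
    {y : B → V} (hy : ContMDiff IB 𝓘(ℝ, V) k y) :
    ContMDiff IB 𝓘(ℝ, V →L[ℝ] V) k (fun x => _root_.tangentialPart (y x)) :=
  (contDiff_const.sub ((_root_.innerSL ℝ (E := V)).contDiff.smulRight contDiff_id)).contMDiff.comp
    hy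

variable [Fintype ι] [DecidableEq ι] {U V : ι → Type*}
  [∀ i, NormedAddCommGroup (U i)] [∀ i, NormedSpace ℝ (U i)]
  [∀ i, NormedAddCommGroup (V i)] [∀ i, InnerProductSpace ℝ (V i)]
  {y : ∀ i, B → V i}

/-- Let `y i` be `C^k` families of unit vectors in the spaces `V i`, of dimension one more than
`U i`. There is a `C^k` family of linear maps `(v, τ)` from `(⨁ i, U i) ⊕ ℝ` to `(⨁ i, V i) ⊕ ℝ`,
with `v i` orthogonal to `y i`, that is injective on the summands `U i`, `i ∈ s`, and the line, even
when only the components `v i`, `i ∈ s`, and `τ` are retained.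

A further index `i` is added by sending the component in `U i` and the line `τ` obtained so far to
`V i` through `κ i`; the part along `y i` is the new line. -/
theorem exists_tangential_family_add_line (κ : ∀ i, (U i × ℝ) ≃L[ℝ] V i)
    (hy : ∀ i, ContMDiff IB 𝓘(ℝ, V i) k (y i)) (hy1 : ∀ i x, ‖y i x‖ = 1) (s : Finset ι) :
    ∃ (v : ∀ i, B → ((∀ i, U i) × ℝ) →L[ℝ] V i) (τ : B → ((∀ i, U i) × ℝ) →L[ℝ] ℝ),
      (∀ i, ContMDiff IB 𝓘(ℝ, ((∀ i, U i) × ℝ) →L[ℝ] V i) k (v i)) ∧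
      ContMDiff IB 𝓘(ℝ, ((∀ i, U i) × ℝ) →L[ℝ] ℝ) k τ ∧
      (∀ i x e, ⟪y i x, v i x e⟫ = 0) ∧
      ∀ x e, (∀ i ∈ s, v i x e = 0) → τ x e = 0 → e.2 = 0 ∧ ∀ i ∈ s, e.1 i = 0 := by
  induction s using Finset.induction_on with
  | empty =>
    refine ⟨fun i _ => 0, fun _ => ContinuousLinearMap.snd ℝ _ _, fun i => contMDiff_const,
      contMDiff_const, fun i x e => by simp, fun x e _ h => ⟨h, by simp⟩⟩
  | insert i s hi ih =>
    obtain ⟨v, τ, hv, hτ, hvt, hinj⟩ := ih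
    let z : B → ((∀ i, U i) × ℝ) →L[ℝ] V i := fun x =>
      (κ i : (U i × ℝ) →L[ℝ] V i) ∘L
        (ContinuousLinearMap.inl ℝ (U i) ℝ ∘L ContinuousLinearMap.proj i ∘L
            ContinuousLinearMap.fst ℝ (∀ i, U i) ℝ +
          ContinuousLinearMap.inr ℝ (U i) ℝ ∘L τ x)
    have hz : ContMDiff IB 𝓘(ℝ, ((∀ i, U i) × ℝ) →L[ℝ] V i) k z :=
      contMDiff_const.clm_comp (contMDiff_const.add (contMDiff_const.clm_comp hτ))
    have hz_apply (x e) : z x e = κ i (e.1 i, τ x e) := by simp [z, ← map_add]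
    refine ⟨Function.update v i fun x => tangentialPart (y i x) ∘L z x,
      fun x => innerSL ℝ (y i x) ∘L z x, fun j => ?_, (hy i).innerSL.clm_comp hz,
      fun j x e => ?_, fun x e h0 hτ0 => ?_⟩
    · obtain rfl | hj := eq_or_ne j i
      · rw [Function.update_self]
        exact (hy j).tangentialPart.clm_comp hz
      · rw [Function.update_of_ne hj]
        exact hv j
    · obtain rfl | hj := eq_or_ne j i
      · rw [Function.update_self]
        exact inner_tangentialPart (hy1 j x) _
      · rw [Function.update_of_ne hj]
        exact hvt j x e
    · have hzt : tangentialPart (y i x) (z x e) = 0 := by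
        simpa using h0 i (Finset.mem_insert_self i s)
      have hz0 : κ i (e.1 i, τ x e) = 0 := by
        have hτ0' : ⟪y i x, z x e⟫ = 0 := hτ0
        rw [← hz_apply, ← hzt, tangentialPart_of_inner_eq_zero hτ0']
      rw [map_eq_zero_iff _ (κ i).injective, Prod.mk_eq_zero] at hz0
      have hrest := hinj x e (fun j hj => by
        have hji : j ≠ i := fun h => hi (h ▸ hj)
        simpa [hji] using h0 j (Finset.mem_insert_of_mem hj)) hz0.2
      exact ⟨hrest.1, (Finset.forall_mem_insert _ _ _).2 ⟨hz0.1, hrest.2⟩⟩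

/-- If `J (y a)` is a unit vector orthogonal to `y a` and some other `U b` is nonzero (witnessed by
the coordinate `l` with `l u₀ = 1`), then the line in `exists_tangential_family_add_line` is not
needed: there is a `C^k` family of injective linear maps `v` from `⨁ i, U i` to `⨁ i, V i` with `v i`
orthogonal to `y i`. -/
theorem exists_tangential_family (κ : ∀ i, (U i × ℝ) ≃L[ℝ] V i)
    (hy : ∀ i, ContMDiff IB 𝓘(ℝ, V i) k (y i)) (hy1 : ∀ i x, ‖y i x‖ = 1)
    {a b : ι} (hab : a ≠ b) (J : V a →L[ℝ] V a) (hJ : ∀ z, ⟪z, J z⟫ = 0) (hJn : ∀ z, ‖J z‖ = ‖z‖)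
    (l : U b →L[ℝ] ℝ) (u₀ : U b) (hl : l u₀ = 1) :
    ∃ v : ∀ i, B → (∀ i, U i) →L[ℝ] V i,
      (∀ i, ContMDiff IB 𝓘(ℝ, (∀ i, U i) →L[ℝ] V i) k (v i)) ∧
      (∀ i x u, ⟪y i x, v i x u⟫ = 0) ∧ ∀ x u, (∀ i, v i x u = 0) → u = 0 := by
  obtain ⟨v, τ, hv, hτ, hvt, hinj⟩ :=
    exists_tangential_family_add_line κ hy hy1 (Finset.univ.erase a)
  have hJy : ContMDiff IB 𝓘(ℝ, V a) k (fun x => J (y a x)) := J.contDiff.contMDiff.comp (hy a)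
  have hJy1 (x) : ‖J (y a x)‖ = 1 := by rw [hJn, hy1]
  -- The coordinate `l` on `U b` is the line that makes `U a` into `V a`; the tangential part of the
  -- result is `w`, and its coefficient along `y a` replaces `l` in the first component of `P`.
  let z : (∀ i, U i) →L[ℝ] V a := (κ a : (U a × ℝ) →L[ℝ] V a) ∘L
    (ContinuousLinearMap.inl ℝ (U a) ℝ ∘L ContinuousLinearMap.proj a +
      ContinuousLinearMap.inr ℝ (U a) ℝ ∘L l ∘L ContinuousLinearMap.proj b)
  have hz_apply (u) : z u = κ a (u a, l (u b)) := by simp [z, ← map_add]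
  let w : B → (∀ i, U i) →L[ℝ] V a := fun x => tangentialPart (y a x) ∘L z
  have hw : ContMDiff IB 𝓘(ℝ, (∀ i, U i) →L[ℝ] V a) k w :=
    (hy a).tangentialPart.clm_comp contMDiff_const
  have hw_inner (x u) : ⟪y a x, w x u⟫ = 0 := inner_tangentialPart (hy1 a x) _
  -- The second component of `P`, the coefficient of `w` along `J (y a)`, is the line given to the
  -- indices other than `a`.
  let P : B → (∀ i, U i) →L[ℝ] (∀ i, U i) × ℝ := fun x =>
    ContinuousLinearMap.inl ℝ (∀ i, U i) ℝ ∘L (ContinuousLinearMap.id ℝ _ +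
        (ContinuousLinearMap.single ℝ U b ∘L ContinuousLinearMap.toSpanSingleton ℝ u₀) ∘L
          (innerSL ℝ (y a x) ∘L z - l ∘L ContinuousLinearMap.proj b)) +
      ContinuousLinearMap.inr ℝ (∀ i, U i) ℝ ∘L innerSL ℝ (J (y a x)) ∘L w x
  have hP : ContMDiff IB 𝓘(ℝ, (∀ i, U i) →L[ℝ] (∀ i, U i) × ℝ) k P :=
    (contMDiff_const.clm_comp (contMDiff_const.add (contMDiff_const.clm_comp
      (((hy a).innerSL.clm_comp contMDiff_const).sub contMDiff_const)))).add
      (contMDiff_const.clm_comp (hJy.innerSL.clm_comp hw))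
  have hP_fst (x u) : (P x u).1 = u + Pi.single b ((⟪y a x, z u⟫ - l (u b)) • u₀) := by
    simp [P, sub_smul, Pi.single_sub, Pi.single_smul]
  have hP_snd (x u) : (P x u).2 = ⟪J (y a x), w x u⟫ := by simp [P]
  -- The line `τ` left over by these indices is the new coefficient along `J (y a)`.
  let va : B → (∀ i, U i) →L[ℝ] V a := fun x =>
    tangentialPart (J (y a x)) ∘L w x +
      ContinuousLinearMap.toSpanSingleton ℝ (J (y a x)) ∘L τ x ∘L P x
  have hva_apply (x u) : va x u = tangentialPart (J (y a x)) (w x u) + τ x (P x u) • J (y a x) := by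
    simp [va]
  have hva : ContMDiff IB 𝓘(ℝ, (∀ i, U i) →L[ℝ] V a) k va := by
    refine (hJy.tangentialPart.clm_comp hw).add (ContMDiff.clm_comp ?_ (hτ.clm_comp hP))
    exact (ContinuousLinearMap.toSpanSingletonCLE (𝕜 := ℝ) (E := V a)).contDiff.contMDiff.comp hJy
  refine ⟨Function.update (fun i x => v i x ∘L P x) a va, fun j => ?_, fun j x u => ?_,
    fun x u h0 => ?_⟩
  · obtain rfl | hj := eq_or_ne j a
    · rw [Function.update_self]
      exact hva
    · rw [Function.update_of_ne hj]
      exact (hv j).clm_comp hP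
  · obtain rfl | hj := eq_or_ne j a
    · rw [Function.update_self, hva_apply, inner_add_right, tangentialPart_apply, inner_sub_right,
        inner_smul_right, inner_smul_right, hJ, hw_inner]
      ring
    · rw [Function.update_of_ne hj]
      exact hvt j x (P x u)
  · have ha : tangentialPart (J (y a x)) (w x u) + τ x (P x u) • J (y a x) = 0 := by
      rw [← hva_apply]
      simpa using h0 a
    have hτ0 : τ x (P x u) = 0 := by
      have := congrArg (fun t => ⟪J (y a x), t⟫) ha
      simpa [inner_add_right, inner_tangentialPart (hJy1 x), inner_smul_right, hJy1 x] using this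
    obtain ⟨h2, h1⟩ := hinj x (P x u) (fun j hj => by
      have hja : j ≠ a := Finset.ne_of_mem_erase hj
      simpa [hja] using h0 j) hτ0
    rw [hτ0, zero_smul, add_zero] at ha
    rw [hP_snd] at h2
    have hw0 : w x u = 0 := by rw [← ha, tangentialPart_of_inner_eq_zero h2]
    have hb := h1 b (Finset.mem_erase.2 ⟨hab.symm, Finset.mem_univ b⟩)
    rw [hP_fst, Pi.add_apply, Pi.single_eq_same] at hb
    have hc : ⟪y a x, z u⟫ = 0 := by
      have := congrArg l hb
      simpa [hl] using this
    have hz0 : κ a (u a, l (u b)) = 0 := by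
      rw [← hz_apply, ← tangentialPart_of_inner_eq_zero hc]
      exact hw0
    rw [map_eq_zero_iff _ (κ a).injective, Prod.mk_eq_zero] at hz0
    funext i
    obtain rfl | hia := eq_or_ne i a
    · exact hz0.1
    obtain rfl | hib := eq_or_ne i b
    · simpa [hc, hz0.2] using hb
    · have := h1 i (Finset.mem_erase.2 ⟨hia, Finset.mem_univ i⟩)
      simpa [hP_fst, hib] using this

end Families

/-! ### An orthogonal complex structure, and frames from families of linear maps -/

section Frames

/-- The rotation `(p, q) ↦ (-q, p)`. -/
theorem exists_quarterTurn (F : Type*) [NormedAddCommGroup F] [InnerProductSpace ℝ F] :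
    ∃ R : WithLp 2 (F × F) →ₗ[ℝ] WithLp 2 (F × F), (∀ p, ⟪p, R p⟫ = 0) ∧ ∀ p, ‖R p‖ = ‖p‖ := by
  refine ⟨(WithLp.linearEquiv 2 ℝ (F × F)).symm.toLinearMap ∘ₗ
    ((-LinearMap.snd ℝ F F).prod (LinearMap.fst ℝ F F)) ∘ₗ
    (WithLp.linearEquiv 2 ℝ (F × F)).toLinearMap, fun p => ?_, fun p => ?_⟩
  · rw [WithLp.prod_inner_apply]
    simp only [LinearMap.comp_apply, LinearEquiv.coe_coe]
    change ⟪p.fst, -p.snd⟫ + ⟪p.snd, p.fst⟫ = 0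
    rw [inner_neg_right, real_inner_comm, neg_add_cancel]
  · rw [WithLp.prod_norm_eq_of_L2, WithLp.prod_norm_eq_of_L2]
    change √(‖-p.snd‖ ^ 2 + ‖p.fst‖ ^ 2) = _
    rw [norm_neg, add_comm]

theorem exists_orthogonal_complexStructure {m : ℕ} (hm : Odd m) :
    ∃ J : EuclideanSpace ℝ (Fin (m + 1)) →L[ℝ] EuclideanSpace ℝ (Fin (m + 1)),
      (∀ z, ⟪z, J z⟫ = 0) ∧ ∀ z, ‖J z‖ = ‖z‖ := by
  obtain ⟨q, rfl⟩ := hm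
  obtain ⟨R, hR, hRn⟩ := exists_quarterTurn (EuclideanSpace ℝ (Fin (q + 1)))
  have hdim : Module.finrank ℝ
      (WithLp 2 (EuclideanSpace ℝ (Fin (q + 1)) × EuclideanSpace ℝ (Fin (q + 1)))) =
      2 * q + 1 + 1 := by
    rw [(WithLp.linearEquiv 2 ℝ _).finrank_eq, Module.finrank_prod, finrank_euclideanSpace_fin]
    ring
  let φ := ((stdOrthonormalBasis ℝ (WithLp 2 (EuclideanSpace ℝ (Fin (q + 1)) ×
    EuclideanSpace ℝ (Fin (q + 1))))).reindex (finCongr hdim)).repr.symm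
  refine ⟨LinearMap.toContinuousLinearMap
    (φ.symm.toLinearEquiv.toLinearMap ∘ₗ R ∘ₗ φ.toLinearEquiv.toLinearMap), fun z => ?_,
    fun z => ?_⟩
  · change ⟪z, φ.symm (R (φ z))⟫ = 0
    rw [← φ.inner_map_map, φ.apply_symm_apply, hR]
  · change ‖φ.symm (R (φ z))‖ = ‖z‖
    rw [φ.symm.norm_map, hRn, φ.norm_map]

/-- The images of a basis of the model fibre form a frame; surjectivity onto the fibres comes from
counting dimensions. -/
theorem IsTrivialVectorBundle.of_injective {E H M F : Type*} [NormedAddCommGroup E]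
    [NormedSpace ℝ E] [TopologicalSpace H] {I : ModelWithCorners ℝ E H} [TopologicalSpace M]
    [ChartedSpace H M] [NormedAddCommGroup F] [NormedSpace ℝ F] [FiniteDimensional ℝ F]
    {V : M → Type*} [TopologicalSpace (Bundle.TotalSpace F V)]
    [∀ x, AddCommGroup (V x)] [∀ x, Module ℝ (V x)] [∀ x, TopologicalSpace (V x)]
    [FiberBundle F V] [VectorBundle ℝ F V] (L : ∀ x, F →ₗ[ℝ] V x)
    (hinj : ∀ x, Function.Injective (L x))
    (hL : ∀ e, ContMDiff I (I.prod 𝓘(ℝ, F)) ∞ (fun x => Bundle.TotalSpace.mk' F x (L x e))) :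
    IsTrivialVectorBundle I F V := by
  let b := Module.finBasis ℝ F
  let c (x : M) := (trivializationAt F V x).continuousLinearEquivAt ℝ x
    (FiberBundle.mem_baseSet_trivializationAt F V x)
  refine ⟨fun j x => L x (b j), fun {x} _ => b.linearIndependent.map' (L x)
    (LinearMap.ker_eq_bot.2 (hinj x)), fun {x} _ => ?_, fun j => (hL (b j)).contMDiffOn⟩
  have : FiniteDimensional ℝ (V x) := (c x).symm.toLinearEquiv.finiteDimensional
  have hsurj := (LinearMap.injective_iff_surjective_of_finrank_eq_finrank
    (c x).toLinearEquiv.finrank_eq.symm).1 (hinj x)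
  rw [range_comp' (L x) b, Submodule.span_image, b.span_eq, Submodule.map_top,
    LinearMap.range_eq_top.2 hsurj]

end Frames

/-! ### Products of spheres -/

noncomputable section SphereProducts

variable {r : ℕ} {n : Fin r → ℕ}

/-- The direct sum of the surjections `StdSphere.toTangent`, applied to a tuple of linear
parametrizations of vectors in the ambient spaces. -/
def SphereProduct.toTangentMap {P : Type*} [NormedAddCommGroup P] [NormedSpace ℝ P]
    (x : SphereProduct n) (v : ∀ i, P →L[ℝ] EuclideanSpace ℝ (Fin (n i + 1))) :
    P →ₗ[ℝ] TangentSpace (sphereProductModel n) x :=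
  LinearMap.pi (R := ℝ) (φ := fun i => EuclideanSpace ℝ (Fin (n i)))
    fun i => ((x i).toTangent ∘L v i : P →L[ℝ] TangentSpace (𝓡 (n i)) (x i)).toLinearMap

/-- On vectors orthogonal to the `x i`, the map `toTangentMap` loses nothing: the differentials of
the inclusions of the spheres give the vectors back. -/
theorem SphereProduct.eq_zero_of_toTangentMap_eq_zero {P : Type*} [NormedAddCommGroup P]
    [NormedSpace ℝ P] {x : SphereProduct n} {v : ∀ i, P →L[ℝ] EuclideanSpace ℝ (Fin (n i + 1))}
    {e : P} (hv : ∀ i, ⟪(x i : EuclideanSpace ℝ (Fin (n i + 1))), v i e⟫ = 0)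
    (h : SphereProduct.toTangentMap x v e = 0) (i : Fin r) : v i e = 0 := by
  have hi : (x i).toTangent (v i e) = 0 := congrFun h i
  rw [← tangentialPart_of_inner_eq_zero (hv i), ← StdSphere.mfderiv_coe_toTangent, hi, map_zero]
  rfl

theorem SphereProduct.contMDiff_toTangentMap {P : Type*} [NormedAddCommGroup P] [NormedSpace ℝ P]
    {v : ∀ i, SphereProduct n → P →L[ℝ] EuclideanSpace ℝ (Fin (n i + 1))}
    (hv : ∀ i, ContMDiff (sphereProductModel n)
      𝓘(ℝ, P →L[ℝ] EuclideanSpace ℝ (Fin (n i + 1))) ∞ (v i)) (e : P) :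
    ContMDiff (sphereProductModel n) (sphereProductModel n).tangent ∞
      (fun x => (⟨x, SphereProduct.toTangentMap x (fun i => v i x) e⟩ :
        TangentBundle (sphereProductModel n) (SphereProduct n))) :=
  contMDiff_pi_section (I := fun i => 𝓡 (n i))
    (s := fun (x : SphereProduct n) i => (x i).toTangent (v i x e)) fun i =>
      StdSphere.contMDiff_toTangent (l := ∞) (by simp) (contMDiff_eval_pi (I := fun i => 𝓡 (n i)) i)
        ((hv i).clm_apply contMDiff_const)

theorem SphereProduct.contMDiff_coe (i : Fin r) :
    ContMDiff (sphereProductModel n) 𝓘(ℝ, EuclideanSpace ℝ (Fin (n i + 1))) ∞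
      (fun x : SphereProduct n => (x i : EuclideanSpace ℝ (Fin (n i + 1)))) :=
  StdSphere.contMDiff_coe.comp (contMDiff_eval_pi (I := fun i => 𝓡 (n i)) i)

/-- An arbitrary linear identification of `ℝᵐ × ℝ` with `ℝᵐ⁺¹`. -/
def euclideanProdLine (m : ℕ) :
    (EuclideanSpace ℝ (Fin m) × ℝ) ≃L[ℝ] EuclideanSpace ℝ (Fin (m + 1)) :=
  ContinuousLinearEquiv.ofFinrankEq (by simp)

theorem SphereProduct.tangentPlusLineIsTrivial (n : Fin r → ℕ) :
    TangentPlusLineIsTrivial (sphereProductModel n) (SphereProduct n) := by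
  obtain ⟨v, τ, hv, hτ, hvt, hinj⟩ := exists_tangential_family_add_line
    (IB := sphereProductModel n) (k := ∞)
    (fun i => euclideanProdLine (n i)) (fun i => SphereProduct.contMDiff_coe (n := n) i)
    (fun i x => norm_eq_of_mem_sphere (x i)) Finset.univ
  refine IsTrivialVectorBundle.of_injective
    (fun x => (SphereProduct.toTangentMap x (fun i => v i x)).prod (τ x).toLinearMap)
    (fun x => ?_) (fun e => ?_)
  · rw [injective_iff_map_eq_zero]
    intro e he
    have h1 : SphereProduct.toTangentMap x (fun i => v i x) e = 0 := congrArg Prod.fst he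
    have h2 : τ x e = 0 := congrArg Prod.snd he
    have h := hinj x e (fun i _ => SphereProduct.eq_zero_of_toTangentMap_eq_zero
      (fun j => hvt j x e) h1 i) h2
    exact Prod.ext (funext fun i => h.2 i (Finset.mem_univ i)) h.1
  · exact (SphereProduct.contMDiff_toTangentMap hv e).section_whitneySum
      (ContMDiff.section_trivial (hτ.clm_apply contMDiff_const))

theorem SphereProduct.isParallelizable {a b : Fin r} (hab : a ≠ b) (ha : Odd (n a))
    (hb : 1 ≤ n b) : IsParallelizable (sphereProductModel n) (SphereProduct n) := by
  obtain ⟨J, hJ, hJn⟩ := exists_orthogonal_complexStructure ha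
  obtain ⟨v, hv, hvt, hinj⟩ := exists_tangential_family (IB := sphereProductModel n) (k := ∞)
    (fun i => euclideanProdLine (n i)) (fun i => SphereProduct.contMDiff_coe (n := n) i)
    (fun i x => norm_eq_of_mem_sphere (x i)) hab J hJ hJn
    (EuclideanSpace.proj ⟨0, hb⟩) (EuclideanSpace.single ⟨0, hb⟩ 1) (by simp)
  refine IsTrivialVectorBundle.of_injective
    (fun x => SphereProduct.toTangentMap x (fun i => v i x)) (fun x => ?_)
    (fun e => SphereProduct.contMDiff_toTangentMap hv e)
  rw [injective_iff_map_eq_zero]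
  exact fun e he => hinj x e
    (SphereProduct.eq_zero_of_toTangentMap_eq_zero (fun j => hvt j x e) he)

end SphereProducts

theorem mainTheorem6 (r : ℕ) (hr : 1 ≤ r) (n : Fin r → ℕ) (hn : ∀ i, 1 ≤ n i) :
    TangentPlusLineIsTrivial (sphereProductModel n) (SphereProduct n) ∧
    (2 ≤ r → (∃ i, Odd (n i)) →
      IsParallelizable (sphereProductModel n) (SphereProduct n)) := by
  refine ⟨SphereProduct.tangentPlusLineIsTrivial n, fun h2 ⟨a, ha⟩ => ?_⟩
  have : Nontrivial (Fin r) := Fin.nontrivial_iff_two_le.2 h2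
  obtain ⟨b, hab⟩ := exists_ne a
  exact SphereProduct.isParallelizable hab.symm ha (hn b)
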